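/- All Hilbert spaces are complex and finite dimensional. A density matrix $\rho$ on $\mathcal H$ is a positive semidefinite operator with $\operatorname{Tr}\rho=1$, and its von Neumann entropy is $S(\rho)=-\operatorname{Tr}[\rho\log\rho]$ (with $0\log 0=0$). For a density matrix $\rho_{123}$ on $\mathcal H_1\otimes\mathcal H_2\otimes\mathcal H_3$, write $\rho_A$ for its partial trace over the factors not in $A\subseteq\{1,2,3\}$ and $S_A=S(\rho_A)$; similarly for a density matrix $\rho_{12}$ on $\mathcal H_1\otimes\mathcal H_2$. The squashed entanglement of $\rho_{12}$ is $$E_{\rm sq}(\rho_{12})=\tfrac12\inf\{S_{13}+S_{23}-S_{123}-S_3\},$$ where the infimum is over all finite-dimensional $\mathcal H_3$ and all density matrices $\rho_{123}$ on $\mathcal H_1\otimes\mathcal H_2\otimes\mathcal H_3$ with $\operatorname{Tr}_3\rho_{123}=\rho_{12}$. **Theorem (extended strong subadditivity).** For every density matrix $\rho_{123}$ on $\mathcal H_1\otimes\mathcal H_2\otimes\mathcal H_3$, $$S_{13}+S_{23}-S_{123}-S_3\ \ge\ 2\max\{S_1-S_{12},\ S_2-S_{12},\ 0\}.$$ Consequently,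 for every density matrix $\rho_{12}$ on $\mathcal H_1\otimes\mathcal H_2$, the infimum defining $E_{\rm sq}(\rho_{12})$ is over a nonempty set of real numbers that is bounded below, and $$E_{\rm sq}(\rho_{12})\ \ge\ \max\{S_1-S_{12},\ S_2-S_{12},\ 0\}.$$ -/

import Mathlib

open scoped ComplexOrder

namespace QuantumState

/-- A density matrix on the finite-dimensional Hilbert space `ℂ^ι`: a positive semidefinite complex
matrix of trace one. -/
def IsDensityMatrix {ι : Type*} [Fintype ι] (ρ : Matrix ι ι ℂ) : Prop :=
  ρ.PosSemidef ∧ ρ.trace = 1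

/-- The von Neumann entropy `S(ρ) = -Tr[ρ log ρ]`, the logarithm being taken in the functional
calculus of Hermitian matrices. As `Real.log 0 = 0`, the kernel of `ρ` contributes nothing, which is
the usual convention `0 log 0 = 0`. -/
noncomputable def entropy {ι : Type*} [Fintype ι] [DecidableEq ι] (ρ : Matrix ι ι ℂ) : ℝ :=
  -(ρ * cfc Real.log ρ).trace.re

section Bipartite

variable {α β : Type*}

/-- The partial trace `ρ₁ = Tr₂[ρ₁₂]` of a matrix on `ℂ^α ⊗ ℂ^β = ℂ^(α × β)`. -/
def marginal₁ [Fintype β] (ρ : Matrix (α × β) (α × β) ℂ) : Matrix α α ℂ :=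
  Matrix.of fun i i' => ∑ j, ρ (i, j) (i', j)

/-- The partial trace `ρ₂ = Tr₁[ρ₁₂]` of a matrix on `ℂ^α ⊗ ℂ^β = ℂ^(α × β)`. -/
def marginal₂ [Fintype α] (ρ : Matrix (α × β) (α × β) ℂ) : Matrix β β ℂ :=
  Matrix.of fun j j' => ∑ i, ρ (i, j) (i, j')

end Bipartite

section Tripartite

variable {α β γ : Type*}

/-- The partial trace `ρ₁₂ = Tr₃[ρ₁₂₃]` of a matrix on `ℂ^α ⊗ ℂ^β ⊗ ℂ^γ = ℂ^(α × β × γ)`. -/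
def marginal₁₂ [Fintype γ] (ρ : Matrix (α × β × γ) (α × β × γ) ℂ) : Matrix (α × β) (α × β) ℂ :=
  Matrix.of fun p q => ∑ k, ρ (p.1, p.2, k) (q.1, q.2, k)

/-- The partial trace `ρ₁₃ = Tr₂[ρ₁₂₃]`. -/
def marginal₁₃ [Fintype β] (ρ : Matrix (α × β × γ) (α × β × γ) ℂ) : Matrix (α × γ) (α × γ) ℂ :=
  Matrix.of fun p q => ∑ j, ρ (p.1, j, p.2) (q.1, j, q.2)

/-- The partial trace `ρ₂₃ = Tr₁[ρ₁₂₃]`. -/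
def marginal₂₃ [Fintype α] (ρ : Matrix (α × β × γ) (α × β × γ) ℂ) : Matrix (β × γ) (β × γ) ℂ :=
  Matrix.of fun p q => ∑ i, ρ (i, p.1, p.2) (i, q.1, q.2)

variable [Fintype α] [DecidableEq α] [Fintype β] [DecidableEq β] [Fintype γ] [DecidableEq γ]

/-- The conditional mutual information `I(1,2|3) = S₁₃ + S₂₃ - S₁₂₃ - S₃`. -/
noncomputable def condMutualInfo (ρ : Matrix (α × β × γ) (α × β × γ) ℂ) : ℝ :=
  entropy (marginal₁₃ ρ) + entropy (marginal₂₃ ρ) - entropy ρ - entropy (marginal₂ (marginal₂₃ ρ))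

end Tripartite

section Squashed

variable {α β : Type*} [Fintype α] [DecidableEq α] [Fintype β] [DecidableEq β]

/-- The values `I(1,2|3)` over all tripartite extensions of `ρ₁₂`, that is, over all density
matrices `ρ₁₂₃` with `Tr₃[ρ₁₂₃] = ρ₁₂`, the third Hilbert space being `ℂⁿ` with `n` arbitrary. -/
def extensionInfoSet (ρ₁₂ : Matrix (α × β) (α × β) ℂ) : Set ℝ :=
  {x | ∃ (n : ℕ) (ρ : Matrix (α × β × Fin n) (α × β × Fin n) ℂ),
    IsDensityMatrix ρ ∧ marginal₁₂ ρ = ρ₁₂ ∧ x = condMutualInfo ρ}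

/-- The squashed entanglement: half of the infimum of `I(1,2|3)` over all tripartite extensions. -/
noncomputable def squashedEntanglement (ρ₁₂ : Matrix (α × β) (α × β) ℂ) : ℝ :=
  (1 / 2) * sInf (extensionInfoSet ρ₁₂)

end Squashed

end QuantumState

/-! Strong subadditivity with pivot 1, `S₁₂₃ + S₁ ≤ S₁₂ + S₁₃`, and weak monotonicity, `S₁ + S₃ ≤
S₁₂ + S₂₃`, add up to the bound by `2(S₁ - S₁₂)`. Exchanging 1 and 2 gives the second bound, and
pivot 3 gives nonnegativity. Weak monotonicity is strong subadditivity for `ρ₁₂₄`, where 4 purifies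
`ρ₁₂₃`, because complementary parts of a pure state have equal entropy.

Strong subadditivity is monotonicity of `D(ρ₁₂₃‖ρ₁₂ ⊗ 1) = S₁₂ - S₁₂₃` under `Tr₁`
(`relEntropy_le_of_trace_dual`). For that, `D(ρ‖σ)` is the limit as `T → ∞` of `∫₀ᵀ F_t dt - Tr[ρ]
log T`, where `F_t` is the maximum over `X` of `resolventForm t ρ σ X`. The form of the reduced pair
at `X` equals that of the original pair at the embedded `X`, so the reduced maximum runs over fewer
competitors. Hence `F_t` can only decrease, and so does `D`. -/

namespace QuantumState

/-! ### Entropy through eigenvalues -/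

section SpectralData

variable {n : Type*} [Fintype n] [DecidableEq n]

/-- A unitary diagonalisation of a Hermitian matrix which also diagonalises its functional
calculus. -/
lemma exists_unitary_diagonalization {A : Matrix n n ℂ} (hA : A.IsHermitian) :
    ∃ U : Matrix n n ℂ, U.conjTranspose * U = 1 ∧ U * U.conjTranspose = 1 ∧
      A = U * Matrix.diagonal (fun i => (hA.eigenvalues i : ℂ)) * U.conjTranspose ∧
      ∀ f : ℝ → ℝ, cfc f A
        = U * Matrix.diagonal (fun i => (f (hA.eigenvalues i) : ℂ)) * U.conjTranspose := by
  refine ⟨hA.eigenvectorUnitary, ?_, ?_, ?_, fun f => ?_⟩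
  · exact Unitary.coe_star_mul_self hA.eigenvectorUnitary
  · exact Unitary.coe_mul_star_self hA.eigenvectorUnitary
  · conv_lhs => rw [hA.spectral_theorem]
    rfl
  · rw [hA.cfc_eq]
    rfl

lemma isHermitian_cfc (f : ℝ → ℝ) (A : Matrix n n ℂ) : (cfc f A).IsHermitian :=
  (cfc_predicate f A : IsSelfAdjoint (cfc f A))

lemma trace_cfc {A : Matrix n n ℂ} (hA : A.IsHermitian) (f : ℝ → ℝ) :
    (cfc f A).trace = ∑ i, (f (hA.eigenvalues i) : ℂ) := by
  obtain ⟨U, hU, -, -, h⟩ := exists_unitary_diagonalization hA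
  rw [h f, Matrix.trace_mul_cycle, hU, one_mul, Matrix.trace_diagonal]

lemma continuousOn_spectrum (f : ℝ → ℝ) (A : Matrix n n ℂ) : ContinuousOn f (spectrum ℝ A) :=
  (Matrix.finite_real_spectrum (A := A)).continuousOn f

lemma mul_cfc_log {A : Matrix n n ℂ} (hA : A.IsHermitian) :
    A * cfc Real.log A = cfc (fun x => x * Real.log x) A := by
  have hA' : IsSelfAdjoint A := hA
  conv_lhs => rw [← cfc_id ℝ A hA']
  rw [cfc_id ℝ A hA', cfc_mul (fun x => x) Real.log A (continuousOn_spectrum _ A)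
    (continuousOn_spectrum _ A), cfc_id' ℝ A hA']

lemma entropy_eq_sum {A : Matrix n n ℂ} (hA : A.IsHermitian) :
    entropy A = ∑ i, Real.negMulLog (hA.eigenvalues i) := by
  rw [entropy, mul_cfc_log hA, trace_cfc hA, Complex.re_sum, ← Finset.sum_neg_distrib]
  exact Finset.sum_congr rfl fun i _ => by simp [Real.negMulLog]

/-- The entropy only depends on the characteristic polynomial. -/
lemma entropy_eq_sum_roots {A : Matrix n n ℂ} (hA : A.IsHermitian) :
    entropy A = (A.charpoly.roots.map fun z : ℂ => Real.negMulLog z.re).sum := by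
  rw [entropy_eq_sum hA, hA.roots_charpoly_eq_eigenvalues, Multiset.map_map]
  rfl

lemma entropy_cfc {A : Matrix n n ℂ} (hA : A.IsHermitian) (f : ℝ → ℝ) :
    entropy (cfc f A) = ∑ i, Real.negMulLog (f (hA.eigenvalues i)) := by
  rw [entropy_eq_sum_roots (isHermitian_cfc f A), hA.charpoly_cfc_eq,
    Polynomial.roots_prod _ _ (Finset.prod_ne_zero_iff.2 fun i _ => Polynomial.X_sub_C_ne_zero _)]
  simp [Multiset.bind_singleton]

lemma entropy_add_smul_one {A : Matrix n n ℂ} (hA : A.IsHermitian) (ε : ℝ) :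
    entropy (A + (ε : ℂ) • 1) = ∑ i, Real.negMulLog (hA.eigenvalues i + ε) := by
  rw [← entropy_cfc hA (fun x => x + ε)]
  obtain ⟨U, -, hU, h, hf⟩ := exists_unitary_diagonalization hA
  congr 1
  rw [hf]
  simp_rw [Complex.ofReal_add, ← Matrix.diagonal_add, mul_add, add_mul, ← h]
  rw [add_right_inj, ← Matrix.smul_one_eq_diagonal]
  simp [hU]

/-- `Real.negMulLog` is continuous even at 0, so entropy inequalities pass from definite to
semidefinite matrices. The factor `c` absorbs the dimension by which a partial trace multiplies the
identity. -/
lemma tendsto_entropy_add_smul_one {A : Matrix n n ℂ} (hA : A.IsHermitian) {c : ℝ} :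
    Filter.Tendsto (fun ε : ℝ => entropy (A + ((c * ε : ℝ) : ℂ) • 1)) (nhdsWithin 0 (Set.Ioi 0))
      (nhds (entropy A)) := by
  simp_rw [entropy_add_smul_one hA]
  rw [entropy_eq_sum hA]
  refine tendsto_nhdsWithin_of_tendsto_nhds ?_
  refine tendsto_finsetSum _ fun i _ => ?_
  have : Continuous fun ε : ℝ => Real.negMulLog (hA.eigenvalues i + c * ε) :=
    Real.continuous_negMulLog.comp (by fun_prop)
  simpa using this.tendsto 0

lemma entropy_transpose {A : Matrix n n ℂ} (hA : A.IsHermitian) :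
    entropy A.transpose = entropy A := by
  rw [entropy_eq_sum_roots hA, entropy_eq_sum_roots hA.transpose, Matrix.charpoly_transpose]

lemma entropy_submatrix {m : Type*} [Fintype m] [DecidableEq m] {A : Matrix n n ℂ}
    (hA : A.IsHermitian) (e : m ≃ n) : entropy (A.submatrix e e) = entropy A := by
  have h : A.submatrix e e = Matrix.reindex e.symm e.symm A := rfl
  rw [entropy_eq_sum_roots hA, entropy_eq_sum_roots (hA.submatrix e), h, Matrix.charpoly_reindex]

/-- `B Bᴴ` and `Bᴴ B` have the same nonzero eigenvalues, hence the same entropy. -/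
lemma entropy_mul_conjTranspose_comm {m : Type*} [Fintype m] [DecidableEq m] (B : Matrix m n ℂ) :
    entropy (B * B.conjTranspose) = entropy (B.conjTranspose * B) := by
  rw [entropy_eq_sum_roots (Matrix.isHermitian_mul_conjTranspose_self B),
    entropy_eq_sum_roots (Matrix.isHermitian_conjTranspose_mul_self B)]
  have h := congrArg Polynomial.roots (Matrix.charpoly_mul_comm' B B.conjTranspose)
  -- The surplus roots are all zero and contribute `negMulLog 0 = 0`.
  have h0 : ∀ (k : ℕ) {p : Polynomial ℂ}, p.Monic →
      ((Polynomial.X ^ k * p).roots.map fun z : ℂ => Real.negMulLog z.re).sum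
        = (p.roots.map fun z : ℂ => Real.negMulLog z.re).sum := fun k p hp => by
    rw [Polynomial.roots_mul (mul_ne_zero (pow_ne_zero _ Polynomial.X_ne_zero) hp.ne_zero)]
    simp [Multiset.map_nsmul, Multiset.sum_nsmul]
  rw [← h0 _ (Matrix.charpoly_monic _), h, h0 _ (Matrix.charpoly_monic _)]

end SpectralData

/-! ### Variational formula and monotonicity of relative entropy -/

section RelativeEntropy

variable {n : Type*} [Fintype n] [DecidableEq n]

/-- The relative entropy `D(ρ‖σ) = Tr[ρ log ρ] - Tr[ρ log σ]` of positive definite matrices. -/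
noncomputable def relEntropy (ρ σ : Matrix n n ℂ) : ℝ :=
  (ρ * cfc Real.log ρ).trace.re - (ρ * cfc Real.log σ).trace.re

/-- The quadratic form in `X` whose maximum is `Tr[ρ (t L_ρ + R_σ)⁻¹ ρ]`, where `L_ρ` and `R_σ` are
the multiplications by `ρ` from the left and by `σ` from the right. It is linear in `(ρ, σ)`. -/
noncomputable def resolventForm (t : ℝ) (ρ σ X : Matrix n n ℂ) : ℝ :=
  2 * (ρ * X).trace.re - (σ * (X.conjTranspose * X)).trace.re
    - t * (ρ * (X * X.conjTranspose)).trace.re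

lemma re_trace_diagonal_mul_mul_conjTranspose (d : n → ℝ) (Y Z : Matrix n n ℂ) :
    (Matrix.diagonal (fun i => (d i : ℂ)) * (Y * Z.conjTranspose)).trace.re
      = ∑ i, ∑ j, d i * (Y i j * star (Z i j)).re := by
  simp only [Matrix.trace, Matrix.diag_apply, Matrix.diagonal_mul]
  simp only [Matrix.mul_apply, Matrix.conjTranspose_apply, Complex.re_sum, Complex.re_ofReal_mul,
    Finset.mul_sum]

lemma trace_conj_mul {m : Type*} [Fintype m] (U D M : Matrix m m ℂ) :
    (U * D * U.conjTranspose * M).trace = (D * (U.conjTranspose * M * U)).trace := by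
  rw [Matrix.mul_assoc, Matrix.mul_assoc, Matrix.trace_mul_comm, Matrix.mul_assoc, Matrix.mul_assoc]

/-- In the two eigenbases the matrix entries of `X` decouple, so the form can be maximised one entry
at a time. -/
lemma resolventForm_eq_sum {U V : Matrix n n ℂ} (hU : U.conjTranspose * U = 1)
    (hV : V.conjTranspose * V = 1) (t : ℝ) (p q : n → ℝ) (Y : Matrix n n ℂ) :
    resolventForm t (U * Matrix.diagonal (fun i => (p i : ℂ)) * U.conjTranspose)
        (V * Matrix.diagonal (fun i => (q i : ℂ)) * V.conjTranspose) (U * Y * V.conjTranspose)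
      = ∑ i, ∑ j, (2 * (p i * (Y i j * star ((U.conjTranspose * V) i j)).re)
          - (q j + t * p i) * Complex.normSq (Y i j)) := by
  have h1 : U.conjTranspose * (U * Y * V.conjTranspose) * U
      = Y * (U.conjTranspose * V).conjTranspose := by
    rw [Matrix.conjTranspose_mul, Matrix.conjTranspose_conjTranspose]
    simp only [← Matrix.mul_assoc, hU, Matrix.one_mul]
  have h2 : U.conjTranspose * ((U * Y * V.conjTranspose) * (U * Y * V.conjTranspose).conjTranspose)
      * U = Y * Y.conjTranspose := by
    simp only [Matrix.conjTranspose_mul, Matrix.conjTranspose_conjTranspose]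
    calc _ = (U.conjTranspose * U) * Y * (V.conjTranspose * V) * Y.conjTranspose
          * (U.conjTranspose * U) := by simp only [Matrix.mul_assoc]
      _ = _ := by simp [hU, hV]
  have h3 : V.conjTranspose * ((U * Y * V.conjTranspose).conjTranspose * (U * Y * V.conjTranspose))
      * V = Y.conjTranspose * Y.conjTranspose.conjTranspose := by
    simp only [Matrix.conjTranspose_mul, Matrix.conjTranspose_conjTranspose]
    calc _ = (V.conjTranspose * V) * Y.conjTranspose * (U.conjTranspose * U) * Y
          * (V.conjTranspose * V) := by simp only [Matrix.mul_assoc]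
      _ = _ := by simp [hU, hV]
  rw [resolventForm, trace_conj_mul, trace_conj_mul, trace_conj_mul, h1,
    h2, h3]
  simp only [re_trace_diagonal_mul_mul_conjTranspose]
  rw [Finset.sum_comm (f := fun i j => q i * _)]
  simp only [Finset.mul_sum, ← Finset.sum_sub_distrib]
  refine Finset.sum_congr rfl fun i _ => Finset.sum_congr rfl fun j _ => ?_
  simp [Complex.normSq_apply]
  ring

/-- Spectral data of a pair of positive definite matrices: the relevant traces and the supremum of
`resolventForm` are sums over pairs of eigenvalues with a common nonnegative weight. -/
lemma exists_joint_spectral_weights {ρ σ : Matrix n n ℂ} (hρ : ρ.PosDef) (hσ : σ.PosDef) :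
    ∃ (w : n → n → ℝ) (p q : n → ℝ), (∀ i, 0 < p i) ∧ (∀ j, 0 < q j) ∧
      ρ.trace.re = ∑ i, ∑ j, w i j * p i ∧
      relEntropy ρ σ = ∑ i, ∑ j, w i j * (p i * (Real.log (p i) - Real.log (q j))) ∧
      ∀ t : ℝ, 0 ≤ t → IsGreatest (Set.range (resolventForm t ρ σ))
        (∑ i, ∑ j, w i j * (p i ^ 2 / (q j + t * p i))) := by
  obtain ⟨U, hU, hU', hρU, hfρ⟩ := exists_unitary_diagonalization hρ.isHermitian
  obtain ⟨V, hV, hV', hσV, hfσ⟩ := exists_unitary_diagonalization hσ.isHermitian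
  have hp := hρ.eigenvalues_pos
  have hq := hσ.eigenvalues_pos
  set p := hρ.isHermitian.eigenvalues
  set q := hσ.isHermitian.eigenvalues
  set W := U.conjTranspose * V with hW
  have hWW : W * W.conjTranspose = 1 := by
    rw [hW, Matrix.conjTranspose_mul, Matrix.conjTranspose_conjTranspose]
    calc _ = U.conjTranspose * (V * V.conjTranspose) * U := by simp only [Matrix.mul_assoc]
      _ = 1 := by simp [hU, hV']
  -- Each row of the unitary `W` has squared moduli summing to 1.
  have hrow : ∀ d : n → ℝ, (Matrix.diagonal (fun i => (d i : ℂ))).trace.re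
      = ∑ i, ∑ j, Complex.normSq (W i j) * d i := fun d => by
    conv_lhs => rw [← Matrix.mul_one (Matrix.diagonal _), ← hWW]
    rw [re_trace_diagonal_mul_mul_conjTranspose]
    refine Finset.sum_congr rfl fun i _ => Finset.sum_congr rfl fun j _ => ?_
    simp [Complex.normSq_apply]
    ring
  have htr : ∀ D : Matrix n n ℂ, (U * D * U.conjTranspose).trace = D.trace := fun D => by
    rw [Matrix.trace_mul_cycle, hU, Matrix.one_mul]
  refine ⟨fun i j => Complex.normSq (W i j), p, q, hp, hq, ?_, ?_, fun t ht => ⟨?_, ?_⟩⟩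
  · rw [← hrow]
    conv_lhs => rw [hρU, htr]
  · have h1 : (ρ * cfc Real.log ρ).trace.re
        = ∑ i, ∑ j, Complex.normSq (W i j) * (p i * Real.log (p i)) := by
      rw [mul_cfc_log hρ.isHermitian, hfρ, htr, hrow]
    have h2 : (ρ * cfc Real.log σ).trace.re
        = ∑ i, ∑ j, Complex.normSq (W i j) * (p i * Real.log (q j)) := by
      have h3 : U.conjTranspose * (V * Matrix.diagonal (fun i => (Real.log (q i) : ℂ))
          * V.conjTranspose) * U
          = (W * Matrix.diagonal (fun i => (Real.log (q i) : ℂ))) * W.conjTranspose := by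
        rw [hW, Matrix.conjTranspose_mul, Matrix.conjTranspose_conjTranspose]
        simp only [Matrix.mul_assoc]
      rw [hfσ, hρU, trace_conj_mul, h3, re_trace_diagonal_mul_mul_conjTranspose]
      refine Finset.sum_congr rfl fun i _ => Finset.sum_congr rfl fun j _ => ?_
      simp [Complex.normSq_apply, Matrix.mul_diagonal]
      ring
    rw [relEntropy, h1, h2]
    simp only [← Finset.sum_sub_distrib]
    refine Finset.sum_congr rfl fun i _ => Finset.sum_congr rfl fun j _ => ?_
    ring
  -- The maximiser is the stationary point of each scalar quadratic.
  · refine ⟨U * (Matrix.of fun i j => ((p i / (q j + t * p i) : ℝ) : ℂ) * W i j)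
      * V.conjTranspose, ?_⟩
    dsimp only
    rw [hρU, hσV, resolventForm_eq_sum hU hV]
    refine Finset.sum_congr rfl fun i _ => Finset.sum_congr rfl fun j _ => ?_
    have hd : 0 < q j + t * p i := add_pos_of_pos_of_nonneg (hq j) (mul_nonneg ht (hp i).le)
    rw [← hW]
    simp only [Matrix.of_apply, Complex.normSq_mul, Complex.normSq_ofReal, mul_assoc,
      Complex.re_ofReal_mul, Complex.star_def, Complex.mul_conj, Complex.ofReal_re]
    field_simp
    ring
  · rintro _ ⟨X, rfl⟩
    have hX : X = U * (U.conjTranspose * X * V) * V.conjTranspose := by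
      calc X = (U * U.conjTranspose) * X * (V * V.conjTranspose) := by simp [hU', hV']
        _ = _ := by simp only [Matrix.mul_assoc]
    rw [hX]
    generalize U.conjTranspose * X * V = Y
    rw [hρU, hσV, resolventForm_eq_sum hU hV]
    refine Finset.sum_le_sum fun i _ => Finset.sum_le_sum fun j _ => ?_
    have hd : 0 < q j + t * p i := add_pos_of_pos_of_nonneg (hq j) (mul_nonneg ht (hp i).le)
    rw [← hW]
    -- Completing the square: expanded, this is the entrywise bound multiplied by `q j + t * p i`.
    have key : 0 ≤ Complex.normSq (((p i : ℝ) : ℂ) * W i j - ((q j + t * p i : ℝ) : ℂ) * Y i j) :=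
      Complex.normSq_nonneg _
    rw [mul_div_assoc', le_div_iff₀ hd]
    simp only [Complex.normSq_apply, Complex.sub_re, Complex.sub_im, Complex.mul_re,
      Complex.mul_im, Complex.ofReal_re, Complex.ofReal_im, Complex.star_def, Complex.conj_re,
      Complex.conj_im] at key ⊢
    nlinarith [key]

/-- The part `∫₀ᵀ` of the integral representation of the relative entropy. -/
lemma tendsto_sum_weights_log {m : Type*} [Fintype m] (w : m → m → ℝ) {p q : m → ℝ}
    (hp : ∀ i, 0 < p i) :
    Filter.Tendsto (fun T : ℝ => (∑ i, ∑ j, w i j * (p i * (Real.log (q j + T * p i)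
        - Real.log (q j)))) - (∑ i, ∑ j, w i j * p i) * Real.log T)
      Filter.atTop (nhds (∑ i, ∑ j, w i j * (p i * (Real.log (p i) - Real.log (q j))))) := by
  simp only [Finset.sum_mul, ← Finset.sum_sub_distrib]
  refine tendsto_finsetSum _ fun i _ => tendsto_finsetSum _ fun j _ => ?_
  have h1 : Filter.Tendsto (fun T : ℝ => Real.log (q j / T + p i)) Filter.atTop
      (nhds (Real.log (p i))) := by
    have : Filter.Tendsto (fun T : ℝ => q j / T + p i) Filter.atTop (nhds (0 + p i)) :=
      (tendsto_const_nhds.div_atTop Filter.tendsto_id).add tendsto_const_nhds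
    rw [zero_add] at this
    exact this.log (hp i).ne'
  have h2 := ((h1.sub_const (Real.log (q j))).const_mul (p i)).const_mul (w i j)
  refine h2.congr' ?_
  have h3 : ∀ᶠ T : ℝ in Filter.atTop, q j / T + p i ≠ 0 := by
    have : Filter.Tendsto (fun T : ℝ => q j / T + p i) Filter.atTop (nhds (0 + p i)) :=
      (tendsto_const_nhds.div_atTop Filter.tendsto_id).add tendsto_const_nhds
    exact this.eventually_ne (by simpa using (hp i).ne')
  filter_upwards [h3, Filter.eventually_gt_atTop 0] with T hT hT0
  have : q j + T * p i = T * (q j / T + p i) := by field_simp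
  rw [this, Real.log_mul hT0.ne' hT]
  ring

/-- Identifies the logarithmic sum, which vanishes at `T = 0`, as the primitive of the maximum of
`resolventForm`; no integral is needed. -/
lemma hasDerivAt_sum_weights_log {m : Type*} [Fintype m] (w : m → m → ℝ) {p q : m → ℝ}
    (hp : ∀ i, 0 < p i) (hq : ∀ i, 0 < q i) {t : ℝ} (ht : 0 ≤ t) :
    HasDerivAt (fun T : ℝ => ∑ i, ∑ j, w i j * (p i * (Real.log (q j + T * p i)
        - Real.log (q j)))) (∑ i, ∑ j, w i j * (p i ^ 2 / (q j + t * p i))) t := by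
  refine HasDerivAt.fun_sum fun i _ => HasDerivAt.fun_sum fun j _ => ?_
  have hd : 0 < q j + t * p i := add_pos_of_pos_of_nonneg (hq j) (mul_nonneg ht (hp i).le)
  have h := ((((((hasDerivAt_id t).mul_const (p i)).const_add (q j)).log hd.ne').sub_const
    (Real.log (q j))).const_mul (p i)).const_mul (w i j)
  refine h.congr_deriv ?_
  simp only [id_eq]
  ring

/-- Monotonicity of the relative entropy under a map `E` whose trace dual is a unital star
homomorphism, such as a partial trace. -/
theorem relEntropy_le_of_trace_dual {m : Type*} [Fintype m] [DecidableEq m]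
    (φ : Matrix m m ℂ →⋆ₐ[ℂ] Matrix n n ℂ) (E : Matrix n n ℂ → Matrix m m ℂ)
    (hE : ∀ M X, (M * φ X).trace = (E M * X).trace) {ρ σ : Matrix n n ℂ} (hρ : ρ.PosDef)
    (hσ : σ.PosDef) (hEρ : (E ρ).PosDef) (hEσ : (E σ).PosDef) :
    relEntropy (E ρ) (E σ) ≤ relEntropy ρ σ := by
  obtain ⟨w, p, q, hp, hq, htr, hD, hF⟩ := exists_joint_spectral_weights hρ hσ
  obtain ⟨w', p', q', hp', hq', htr', hD', hF'⟩ := exists_joint_spectral_weights hEρ hEσ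
  have htrace : (E ρ).trace = ρ.trace := by simpa using (hE ρ 1).symm
  have hle : ∀ t : ℝ, 0 ≤ t → ∑ i, ∑ j, w' i j * (p' i ^ 2 / (q' j + t * p' i))
      ≤ ∑ i, ∑ j, w i j * (p i ^ 2 / (q j + t * p i)) := fun t ht => by
    obtain ⟨X, hX⟩ := (hF' t ht).1
    rw [← hX]
    refine le_of_eq_of_le ?_ ((hF t ht).2 ⟨φ X, rfl⟩)
    simp only [resolventForm, ← Matrix.star_eq_conjTranspose, ← map_star, ← map_mul, hE]
  have hmono : MonotoneOn (fun T : ℝ =>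
      (∑ i, ∑ j, w i j * (p i * (Real.log (q j + T * p i) - Real.log (q j))))
        - ∑ i, ∑ j, w' i j * (p' i * (Real.log (q' j + T * p' i) - Real.log (q' j))))
      (Set.Ici 0) := by
    have hder := fun (t : ℝ) (ht : 0 ≤ t) => (hasDerivAt_sum_weights_log w hp hq ht).sub
      (hasDerivAt_sum_weights_log w' hp' hq' ht)
    refine monotoneOn_of_deriv_nonneg (convex_Ici 0)
      (fun t ht => (hder t ht).continuousAt.continuousWithinAt)
      (fun t ht => (hder t (interior_subset ht)).differentiableAt.differentiableWithinAt)
      fun t ht => ?_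
    have ht0 : 0 ≤ t := interior_subset ht
    exact (hder t ht0).deriv.symm ▸ sub_nonneg.2 (hle t ht0)
  rw [hD, hD']
  refine le_of_tendsto_of_tendsto (tendsto_sum_weights_log w' hp') (tendsto_sum_weights_log w hp) ?_
  filter_upwards [Filter.eventually_ge_atTop 0] with T hT
  -- Both primitives vanish at 0, so their difference is nonnegative at `T`; the `log T` terms agree
  -- since the traces do.
  have h := hmono (Set.self_mem_Ici) hT hT
  simp only [zero_mul, add_zero, sub_self, mul_zero, Finset.sum_const_zero] at h
  rw [← htr, ← htr', htrace]
  linarith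

end RelativeEntropy

/-- A square root, up to a unitary, of a positive semidefinite matrix. -/
lemma exists_eq_mul_conjTranspose {n : Type*} [Fintype n] [DecidableEq n] {A : Matrix n n ℂ}
    (hA : A.PosSemidef) : ∃ B : Matrix n n ℂ, A = B * B.conjTranspose := by
  obtain ⟨U, -, -, h, -⟩ := exists_unitary_diagonalization hA.isHermitian
  refine ⟨U * Matrix.diagonal fun i => ((√(hA.isHermitian.eigenvalues i) : ℝ) : ℂ), ?_⟩
  rw [Matrix.conjTranspose_mul, ← Matrix.mul_assoc, Matrix.mul_assoc U,
    Matrix.diagonal_conjTranspose, Matrix.diagonal_mul_diagonal]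
  conv_lhs => rw [h]
  congr 3
  ext i
  simp [← Complex.ofReal_mul, Real.mul_self_sqrt (hA.eigenvalues_nonneg i)]

/-! ### Partial trace and its dual embedding -/

section PartialTrace

open scoped Kronecker

variable {ι κ γ : Type*} [Fintype γ]

/-- The partial trace over `ℂ^γ`, for a factorisation `ℂ^ι ≃ ℂ^κ ⊗ ℂ^γ` of the index set. -/
def partialTrace (e : ι ≃ κ × γ) (M : Matrix ι ι ℂ) : Matrix κ κ ℂ :=
  Matrix.of fun a b => ∑ k, M (e.symm (a, k)) (e.symm (b, k))

lemma partialTrace_eq_sum_submatrix (e : ι ≃ κ × γ) (M : Matrix ι ι ℂ) :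
    partialTrace e M
      = ∑ k, M.submatrix (fun a => e.symm (a, k)) (fun a => e.symm (a, k)) := by
  ext a b
  simp [partialTrace, Matrix.sum_apply]

lemma posSemidef_partialTrace (e : ι ≃ κ × γ) {M : Matrix ι ι ℂ} (hM : M.PosSemidef) :
    (partialTrace e M).PosSemidef := by
  rw [partialTrace_eq_sum_submatrix]
  exact Matrix.posSemidef_sum _ fun k _ => hM.submatrix _

lemma posDef_partialTrace [Nonempty γ] (e : ι ≃ κ × γ) {M : Matrix ι ι ℂ} (hM : M.PosDef) :
    (partialTrace e M).PosDef := by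
  rw [partialTrace_eq_sum_submatrix]
  refine Matrix.posDef_sum Finset.univ_nonempty fun k _ => hM.submatrix fun a b h => ?_
  simpa using h

lemma partialTrace_add_smul_one [DecidableEq ι] [DecidableEq κ] (e : ι ≃ κ × γ) (M : Matrix ι ι ℂ) (c : ℝ) :
    partialTrace e (M + (c : ℂ) • 1)
      = partialTrace e M + ((Fintype.card γ * c : ℝ) : ℂ) • 1 := by
  ext a b
  by_cases h : a = b <;>
    simp [partialTrace, Finset.sum_add_distrib, Matrix.one_apply, h]

variable [DecidableEq γ] [Fintype ι] [DecidableEq ι] [Fintype κ] [DecidableEq κ]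

/-- The embedding `X ↦ X ⊗ 1`, for a factorisation `ℂ^ι ≃ ℂ^κ ⊗ ℂ^γ` of the index set. -/
def ampliate (e : ι ≃ κ × γ) : Matrix κ κ ℂ →⋆ₐ[ℂ] Matrix ι ι ℂ where
  toFun X := (X ⊗ₖ (1 : Matrix γ γ ℂ)).submatrix e e
  map_one' := by simp
  map_mul' X Y := by
    rw [Matrix.submatrix_mul_equiv, ← Matrix.mul_kronecker_mul, Matrix.one_mul]
  map_zero' := by simp
  map_add' X Y := by rw [Matrix.add_kronecker]; rfl
  commutes' r := by
    simp [Algebra.algebraMap_eq_smul_one, Matrix.smul_kronecker, Matrix.submatrix_smul]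
  map_star' X := by
    simp [Matrix.star_eq_conjTranspose, Matrix.conjTranspose_kronecker]

lemma ampliate_apply (e : ι ≃ κ × γ) (X : Matrix κ κ ℂ) :
    ampliate e X = (X ⊗ₖ (1 : Matrix γ γ ℂ)).submatrix e e := rfl

lemma trace_mul_ampliate (e : ι ≃ κ × γ) (M : Matrix ι ι ℂ) (X : Matrix κ κ ℂ) :
    (M * ampliate e X).trace = (partialTrace e M * X).trace := by
  have h (a : κ) (k : γ) : (M * ampliate e X) (e.symm (a, k)) (e.symm (a, k))
      = ∑ b, M (e.symm (a, k)) (e.symm (b, k)) * X b a := by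
    rw [Matrix.mul_apply, ← e.symm.sum_comp, Fintype.sum_prod_type]
    simp [ampliate_apply, Matrix.kroneckerMap_apply, Matrix.one_apply]
  rw [Matrix.trace, ← e.symm.sum_comp, Fintype.sum_prod_type]
  simp only [Matrix.trace, Matrix.diag_apply, h, Matrix.mul_apply, partialTrace, Matrix.of_apply,
    Finset.sum_mul]
  exact Finset.sum_congr rfl fun a _ => Finset.sum_comm

lemma posDef_ampliate (e : ι ≃ κ × γ) {X : Matrix κ κ ℂ} (hX : X.PosDef) :
    (ampliate e X).PosDef :=
  (hX.kronecker Matrix.PosDef.one).submatrix e.injective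

lemma cfc_ampliate (e : ι ≃ κ × γ) (f : ℝ → ℝ) {X : Matrix κ κ ℂ} (hX : X.IsHermitian) :
    cfc f (ampliate e X) = ampliate e (cfc f X) := by
  have hc : Continuous (ampliate e) := by
    refine continuous_matrix fun i j => ?_
    simp only [ampliate_apply, Matrix.submatrix_apply, Matrix.kroneckerMap_apply]
    fun_prop
  have hX' : IsSelfAdjoint X := hX
  exact (StarAlgHomClass.map_cfc (S := ℂ) (ampliate e) f X (continuousOn_spectrum f X) hc hX'
    (hX'.map (ampliate e))).symm

/-- The logarithm commutes with `X ↦ X ⊗ 1`, and duality then moves the partial trace onto `ρ`. -/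
lemma relEntropy_ampliate_partialTrace (e : ι ≃ κ × γ) {ρ : Matrix ι ι ℂ} (hρ : ρ.PosSemidef) :
    relEntropy ρ (ampliate e (partialTrace e ρ)) = entropy (partialTrace e ρ) - entropy ρ := by
  rw [relEntropy, cfc_ampliate e _ (posSemidef_partialTrace e hρ).isHermitian, trace_mul_ampliate,
    entropy, entropy]
  ring

end PartialTrace

/-! ### Strong subadditivity and weak monotonicity -/

section StrongSubadditivity

variable {α β γ : Type*}

lemma marginal₁₂_eq_partialTrace [Fintype γ] (ρ : Matrix (α × β × γ) (α × β × γ) ℂ) :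
    marginal₁₂ ρ = partialTrace (Equiv.prodAssoc α β γ).symm ρ := rfl

lemma marginal₂₃_eq_partialTrace [Fintype α] (ρ : Matrix (α × β × γ) (α × β × γ) ℂ) :
    marginal₂₃ ρ = partialTrace (Equiv.prodComm α (β × γ)) ρ := rfl

lemma marginal₂_eq_partialTrace [Fintype α] (ρ : Matrix (α × β) (α × β) ℂ) :
    marginal₂ ρ = partialTrace (Equiv.prodComm α β) ρ := rfl

lemma posSemidef_marginal₁₂ [Fintype γ] {ρ : Matrix (α × β × γ) (α × β × γ) ℂ}
    (hρ : ρ.PosSemidef) : (marginal₁₂ ρ).PosSemidef :=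
  posSemidef_partialTrace (Equiv.prodAssoc α β γ).symm hρ

lemma posSemidef_marginal₂₃ [Fintype α] {ρ : Matrix (α × β × γ) (α × β × γ) ℂ}
    (hρ : ρ.PosSemidef) : (marginal₂₃ ρ).PosSemidef :=
  posSemidef_partialTrace (Equiv.prodComm α (β × γ)) hρ

lemma posSemidef_marginal₂ [Fintype α] {ρ : Matrix (α × β) (α × β) ℂ} (hρ : ρ.PosSemidef) :
    (marginal₂ ρ).PosSemidef :=
  posSemidef_partialTrace (Equiv.prodComm α β) hρ

variable [Fintype α] [Fintype β] [Fintype γ]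
variable [DecidableEq α] [DecidableEq β] [DecidableEq γ]

lemma strong_subadditivity_of_posDef [Nonempty α] [Nonempty γ]
    {ρ : Matrix (α × β × γ) (α × β × γ) ℂ} (hρ : ρ.PosDef) :
    entropy ρ + entropy (marginal₂ (marginal₁₂ ρ))
      ≤ entropy (marginal₁₂ ρ) + entropy (marginal₂₃ ρ) := by
  have h12 : (marginal₁₂ ρ).PosDef := posDef_partialTrace (Equiv.prodAssoc α β γ).symm hρ
  have h23 : (marginal₂₃ ρ).PosDef := posDef_partialTrace (Equiv.prodComm α (β × γ)) hρ
  have h2 : (marginal₂ (marginal₁₂ ρ)).PosDef := posDef_partialTrace (Equiv.prodComm α β) h12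
  have hσ := posDef_ampliate (Equiv.prodAssoc α β γ).symm h12
  -- `Tr₁(ρ₁₂ ⊗ 1) = ρ₂ ⊗ 1`, so the reduced relative entropy is `S₂ - S₂₃`.
  have hE : partialTrace (Equiv.prodComm α (β × γ))
        (ampliate (Equiv.prodAssoc α β γ).symm (marginal₁₂ ρ))
      = ampliate (Equiv.refl _) (marginal₂ (marginal₁₂ ρ)) := by
    ext ⟨j, k⟩ ⟨j', k'⟩
    simp [partialTrace, ampliate_apply, marginal₂, Finset.sum_mul]
  have h22 : marginal₂ (marginal₁₂ ρ) = partialTrace (Equiv.refl _) (marginal₂₃ ρ) := by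
    ext j j'
    simp [partialTrace, marginal₂, marginal₁₂, marginal₂₃]
    exact Finset.sum_comm
  have h := relEntropy_le_of_trace_dual (ampliate (Equiv.prodComm α (β × γ))) _
    (trace_mul_ampliate _) hρ hσ h23 (hE ▸ posDef_ampliate _ h2)
  rw [marginal₁₂_eq_partialTrace, relEntropy_ampliate_partialTrace _ hρ.posSemidef,
    ← marginal₁₂_eq_partialTrace, hE, ← marginal₂₃_eq_partialTrace, h22,
    relEntropy_ampliate_partialTrace _ h23.posSemidef, ← h22] at h
  linarith

/-- **Strong subadditivity** of the von Neumann entropy: `S₁₂₃ + S₂ ≤ S₁₂ + S₂₃`. -/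
theorem strong_subadditivity [Nonempty α] [Nonempty γ]
    {ρ : Matrix (α × β × γ) (α × β × γ) ℂ} (hρ : ρ.PosSemidef) :
    entropy ρ + entropy (marginal₂ (marginal₁₂ ρ))
      ≤ entropy (marginal₁₂ ρ) + entropy (marginal₂₃ ρ) := by
  have h12 := posSemidef_marginal₁₂ hρ
  have h23 := posSemidef_marginal₂₃ hρ
  have h2 := posSemidef_marginal₂ h12
  refine le_of_tendsto_of_tendsto
    ((tendsto_entropy_add_smul_one hρ.isHermitian (c := 1)).add
      (tendsto_entropy_add_smul_one h2.isHermitian (c := Fintype.card α * Fintype.card γ)))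
    ((tendsto_entropy_add_smul_one h12.isHermitian (c := Fintype.card γ)).add
      (tendsto_entropy_add_smul_one h23.isHermitian (c := Fintype.card α))) ?_
  filter_upwards [self_mem_nhdsWithin] with ε hε
  have hpos : (ρ + (ε : ℂ) • 1).PosDef :=
    (Matrix.PosDef.one.smul (by exact_mod_cast Set.mem_Ioi.1 hε)).posSemidef_add hρ
  have h := strong_subadditivity_of_posDef hpos
  simp only [marginal₁₂_eq_partialTrace, marginal₂₃_eq_partialTrace, marginal₂_eq_partialTrace,
    partialTrace_add_smul_one] at h
  simpa only [one_mul, mul_assoc, marginal₁₂_eq_partialTrace, marginal₂₃_eq_partialTrace,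
    marginal₂_eq_partialTrace] using h

/-- Strong subadditivity with pivot `1`: `S₁₂₃ + S₁ ≤ S₁₂ + S₁₃`. -/
theorem strong_subadditivity₁ [Nonempty β] [Nonempty γ]
    {ρ : Matrix (α × β × γ) (α × β × γ) ℂ} (hρ : ρ.PosSemidef) :
    entropy ρ + entropy (marginal₁ (marginal₁₂ ρ))
      ≤ entropy (marginal₁₂ ρ) + entropy (marginal₁₃ ρ) := by
  let e : β × α × γ ≃ α × β × γ := ⟨fun x => (x.2.1, x.1, x.2.2), fun x => (x.2.1, x.1, x.2.2),
    fun _ => rfl, fun _ => rfl⟩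
  have h := strong_subadditivity (hρ.submatrix e)
  have h12 : marginal₁₂ (ρ.submatrix e e)
      = (marginal₁₂ ρ).submatrix (Equiv.prodComm β α) (Equiv.prodComm β α) := rfl
  have hρ12 := posSemidef_marginal₁₂ hρ
  rw [entropy_submatrix hρ.isHermitian, h12, entropy_submatrix hρ12.isHermitian] at h
  exact h

/-- Strong subadditivity with pivot `3`: `S₁₂₃ + S₃ ≤ S₁₃ + S₂₃`. -/
theorem strong_subadditivity₃ [Nonempty α] [Nonempty β]
    {ρ : Matrix (α × β × γ) (α × β × γ) ℂ} (hρ : ρ.PosSemidef) :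
    entropy ρ + entropy (marginal₂ (marginal₂₃ ρ))
      ≤ entropy (marginal₁₃ ρ) + entropy (marginal₂₃ ρ) := by
  let e : α × γ × β ≃ α × β × γ := ⟨fun x => (x.1, x.2.2, x.2.1), fun x => (x.1, x.2.2, x.2.1),
    fun _ => rfl, fun _ => rfl⟩
  have h := strong_subadditivity (hρ.submatrix e)
  have h23 : marginal₂₃ (ρ.submatrix e e)
      = (marginal₂₃ ρ).submatrix (Equiv.prodComm γ β) (Equiv.prodComm γ β) := rfl
  have h3 : marginal₂ (marginal₁₂ (ρ.submatrix e e)) = marginal₂ (marginal₂₃ ρ) := by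
    ext k k'
    exact Finset.sum_comm
  have hρ23 := posSemidef_marginal₂₃ hρ
  rw [entropy_submatrix hρ.isHermitian, h23, entropy_submatrix hρ23.isHermitian, h3] at h
  exact h

/-- Weak monotonicity: `S₁ + S₃ ≤ S₁₂ + S₂₃`. It is strong subadditivity for three of the four
parties of a purification of `ρ`. -/
theorem weak_monotonicity [Nonempty α] [Nonempty β] [Nonempty γ]
    {ρ : Matrix (α × β × γ) (α × β × γ) ℂ} (hρ : ρ.PosSemidef) :
    entropy (marginal₁ (marginal₁₂ ρ)) + entropy (marginal₂ (marginal₂₃ ρ))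
      ≤ entropy (marginal₁₂ ρ) + entropy (marginal₂₃ ρ) := by
  obtain ⟨B, hB⟩ : ∃ B : Matrix (α × β × γ) (α × β × γ) ℂ, ρ = B * B.conjTranspose :=
    exists_eq_mul_conjTranspose hρ
  -- `B` is read as a pure state on four parties, its column index being party 4. `C` and `D` are
  -- this vector cut as 124|3 and 14|23.
  let C : Matrix (α × β × (α × β × γ)) γ ℂ := Matrix.of fun x k => B (x.1, x.2.1, k) x.2.2
  let D : Matrix (α × (α × β × γ)) (β × γ) ℂ := Matrix.of fun x y => B (x.1, y) x.2
  have h := strong_subadditivity₁ (Matrix.posSemidef_self_mul_conjTranspose C)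
  have hρ23 := posSemidef_marginal₂₃ hρ
  have hρ3 := posSemidef_marginal₂ hρ23
  have h12 : marginal₁₂ (C * C.conjTranspose) = marginal₁₂ ρ := by
    ext ⟨i, j⟩ ⟨i', j'⟩
    simp only [marginal₁₂, hB, C, Matrix.of_apply, Matrix.mul_apply, Matrix.conjTranspose_apply]
    exact Finset.sum_comm
  have h13 : marginal₁₃ (C * C.conjTranspose) = D * D.conjTranspose := by
    ext ⟨i, d⟩ ⟨i', d'⟩
    simp only [marginal₁₃, C, D, Matrix.of_apply, Matrix.mul_apply, Matrix.conjTranspose_apply]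
    rw [Fintype.sum_prod_type]
  have h3 : C.conjTranspose * C = (marginal₂ (marginal₂₃ ρ)).transpose := by
    ext k k'
    simp only [marginal₂, marginal₂₃, hB, C, Matrix.of_apply, Matrix.mul_apply,
      Matrix.conjTranspose_apply, Matrix.transpose_apply]
    refine (Fintype.sum_prod_type _).trans ?_
    refine (Finset.sum_congr rfl fun i _ => Fintype.sum_prod_type _).trans
      (Finset.sum_comm.trans ?_)
    exact Finset.sum_congr rfl fun j _ => Finset.sum_congr rfl fun i _ =>
      Finset.sum_congr rfl fun d _ => mul_comm _ _
  have h23 : D.conjTranspose * D = (marginal₂₃ ρ).transpose := by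
    ext ⟨j, k⟩ ⟨j', k'⟩
    simp only [marginal₂₃, hB, D, Matrix.of_apply, Matrix.mul_apply,
      Matrix.conjTranspose_apply, Matrix.transpose_apply, Fintype.sum_prod_type (α₁ := α)
        (α₂ := α × β × γ), mul_comm]
  rw [h12, h13, entropy_mul_conjTranspose_comm C, entropy_mul_conjTranspose_comm D, h3, h23,
    entropy_transpose hρ23.isHermitian, entropy_transpose hρ3.isHermitian] at h
  linarith

end StrongSubadditivity

/-! ### The extended inequality and extensions -/

section ExtendedStrongSubadditivity

variable {α β : Type*} [Fintype α] [DecidableEq α] [Fintype β] [DecidableEq β]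

/-- Extended strong subadditivity. -/
theorem two_mul_max_le_condMutualInfo {γ : Type*} [Fintype γ] [DecidableEq γ]
    {ρ : Matrix (α × β × γ) (α × β × γ) ℂ} (hρ : IsDensityMatrix ρ) :
    2 * max (max (entropy (marginal₁ (marginal₁₂ ρ)) - entropy (marginal₁₂ ρ))
        (entropy (marginal₂ (marginal₁₂ ρ)) - entropy (marginal₁₂ ρ))) 0 ≤ condMutualInfo ρ := by
  obtain ⟨hpos, htr⟩ := hρ
  -- Trace one excludes empty index types.
  obtain ⟨i, j, k⟩ : Nonempty (α × β × γ) := by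
    by_contra h
    rw [not_nonempty_iff] at h
    simp [Matrix.trace] at htr
  have : Nonempty α := ⟨i⟩
  have : Nonempty β := ⟨j⟩
  have : Nonempty γ := ⟨k⟩
  have hpos12 := posSemidef_marginal₁₂ hpos
  have ssa₁ := strong_subadditivity₁ hpos
  have ssa₂ := strong_subadditivity hpos
  have ssa₃ := strong_subadditivity₃ hpos
  have wm₁ := weak_monotonicity hpos
  let e : β × α × γ ≃ α × β × γ := ⟨fun x => (x.2.1, x.1, x.2.2), fun x => (x.2.1, x.1, x.2.2),
    fun _ => rfl, fun _ => rfl⟩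
  have wm₂ := weak_monotonicity (hpos.submatrix e)
  have h12 : marginal₁₂ (ρ.submatrix e e)
      = (marginal₁₂ ρ).submatrix (Equiv.prodComm β α) (Equiv.prodComm β α) := rfl
  have h1 : marginal₁ (marginal₁₂ (ρ.submatrix e e)) = marginal₂ (marginal₁₂ ρ) := rfl
  have h23 : marginal₂₃ (ρ.submatrix e e) = marginal₁₃ ρ := rfl
  have h3 : marginal₂ (marginal₁₃ ρ) = marginal₂ (marginal₂₃ ρ) := by
    ext k k'
    exact Finset.sum_comm
  rw [h1, h12, entropy_submatrix hpos12.isHermitian, h23, h3] at wm₂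
  rw [← le_div_iff₀' two_pos, condMutualInfo]
  refine max_le (max_le ?_ ?_) ?_
  · change entropy _ - entropy (marginal₁₂ ρ) ≤ _
    linarith
  · change entropy _ - entropy (marginal₁₂ ρ) ≤ _
    linarith
  · linarith

/-- Every density matrix has the trivial extension, with a one-dimensional third space. -/
lemma extensionInfoSet_nonempty {ρ₁₂ : Matrix (α × β) (α × β) ℂ} (h : IsDensityMatrix ρ₁₂) :
    (extensionInfoSet ρ₁₂).Nonempty := by
  refine ⟨_, 1, ρ₁₂.submatrix (fun x => (x.1, x.2.1)) (fun x => (x.1, x.2.1)),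
    ⟨h.1.submatrix _, ?_⟩, ?_, rfl⟩
  · rw [← h.2]
    simp [Matrix.trace, Fintype.sum_prod_type]
  · ext x y
    simp [marginal₁₂]

end ExtendedStrongSubadditivity

end QuantumState

theorem theorem6p2 {α β : Type*} [Fintype α] [DecidableEq α] [Fintype β] [DecidableEq β] :
    (∀ (γ : Type*) [Fintype γ] [DecidableEq γ] (ρ : Matrix (α × β × γ) (α × β × γ) ℂ),
      QuantumState.IsDensityMatrix ρ →
        2 * max (max
            (QuantumState.entropy (QuantumState.marginal₁ (QuantumState.marginal₁₂ ρ))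
              - QuantumState.entropy (QuantumState.marginal₁₂ ρ))
            (QuantumState.entropy (QuantumState.marginal₂ (QuantumState.marginal₁₂ ρ))
              - QuantumState.entropy (QuantumState.marginal₁₂ ρ))) 0
          ≤ QuantumState.entropy (QuantumState.marginal₁₃ ρ)
            + QuantumState.entropy (QuantumState.marginal₂₃ ρ)
            - QuantumState.entropy ρ
            - QuantumState.entropy (QuantumState.marginal₂ (QuantumState.marginal₂₃ ρ))) ∧
    (∀ ρ₁₂ : Matrix (α × β) (α × β) ℂ, QuantumState.IsDensityMatrix ρ₁₂ →
      (QuantumState.extensionInfoSet ρ₁₂).Nonempty ∧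
      BddBelow (QuantumState.extensionInfoSet ρ₁₂) ∧
      max (max
          (QuantumState.entropy (QuantumState.marginal₁ ρ₁₂) - QuantumState.entropy ρ₁₂)
          (QuantumState.entropy (QuantumState.marginal₂ ρ₁₂) - QuantumState.entropy ρ₁₂)) 0
        ≤ QuantumState.squashedEntanglement ρ₁₂) := by
  refine ⟨fun γ _ _ ρ hρ => QuantumState.two_mul_max_le_condMutualInfo hρ, fun ρ₁₂ h => ?_⟩
  have hne := QuantumState.extensionInfoSet_nonempty h
  -- The bound depends on the extension only through `ρ₁₂`, so it is uniform over the set.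
  have hlb : ∀ x ∈ QuantumState.extensionInfoSet ρ₁₂, 2 * max (max
      (QuantumState.entropy (QuantumState.marginal₁ ρ₁₂) - QuantumState.entropy ρ₁₂)
      (QuantumState.entropy (QuantumState.marginal₂ ρ₁₂) - QuantumState.entropy ρ₁₂)) 0 ≤ x := by
    rintro _ ⟨n, ρ, hρ, rfl, rfl⟩
    exact QuantumState.two_mul_max_le_condMutualInfo hρ
  refine ⟨hne, ⟨_, hlb⟩, ?_⟩
  have := le_csInf hne hlb
  rw [QuantumState.squashedEntanglement]
  linarith
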